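/- Let $A$ be a finite alphabet with $k=|A|\ge 3$ symbols. A reversible gate is a bijection $A^n\to A^n$ for some $n\in\mathbb N=\mathbb Z_{\ge 0}$. A (reversible) gate class is a set of reversible gates that (1) contains all permutation gates $(a_1,\dots,a_n)\mapsto(a_{\sigma(1)},\dots,a_{\sigma(n)})$, $n\in\mathbb N$, $\sigma\in S_n$; (2) is closed under tensor products $(F\otimes G)(uv)=F(u)G(v)$; (3) is closed under composition of gates of the same arity; (4) is closed under the ancilla rule: if $F:A^{l+n}\to A^{l+n}$ is in the class, $F':A^n\to A^n$ is a reversible gate, and for some $a\in A^l$ one has $F(ab)=aF'(b)$ for all $b\in A^n$, then $F'$ is in the class. Gate classes, ordered by inclusion, form a complete lattice; $\langle X\rangle$ denotes the smallest gate class containing the set $X$ of gates. Let $\lambda$ be a partition of $A$ into one block with $k-1$ elements and one block $\{\kappa\}$, and let $a\in A$, $a\neq\kappa$ (for instance $A=\{1,\dots,k\}$, $\lambda=\{\{1,\dots,k-1\},\{k\}\}$, $\kappa=k$, $a=1$). Let $\mathrm{CONS}_{k-1,1}$ be the class of reversible gates that preserve, for each block of $\lambda$, the number of symbols of the string lying in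 that block. For $m\ge 1$ let $\mathrm{CC}_m:A^{1+m}\to A^{1+m}$ be the gate that exchanges the strings $a\,a^m$ and $a\,\kappa^m$ and fixes all other strings. A gate $F$ is called mod-$m$-preserving if for every input $w$ the numbers of occurrences of $\kappa$ in $F(w)$ and in $w$ are congruent modulo $m$. Theorem. The lattice of gate classes containing $\mathrm{CONS}_{k-1,1}$ is anti-isomorphic to the lattice $(\mathbb N,\mid)$ of non-negative integers ordered by divisibility ($n\le m$ if and only if $n\mid m$). More precisely, there is an anti-isomorphism under which $0$ corresponds to $\mathrm{CONS}_{k-1,1}$ and every $m\ge 1$ corresponds to $\langle \mathrm{CONS}_{k-1,1}\cup\{\mathrm{CC}_m\}\rangle$, and this last class is exactly the set of all mod-$m$-preserving gates. -/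

import Mathlib

/-- A reversible gate over the alphabet `A`: an arity `n` together with a bijection `A^n → A^n`. -/
abbrev Gate (A : Type*) := Σ n : ℕ, Equiv.Perm (Fin n → A)

namespace Gate

/-- The permutation gate `P_σ : (a_1, …, a_n) ↦ (a_{σ(1)}, …, a_{σ(n)})`. -/
def permGate (A : Type*) {n : ℕ} (σ : Equiv.Perm (Fin n)) : Equiv.Perm (Fin n → A) where
  toFun w := w ∘ σ
  invFun w := w ∘ σ.symm
  left_inv w := by funext i; simp
  right_inv w := by funext i; simp

/-- The tensor product `F ⊗ G`, acting by `F` on the first `k` symbols and by `G` on the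
last `l` symbols. -/
def tensor {A : Type*} {k l : ℕ} (F : Equiv.Perm (Fin k → A)) (G : Equiv.Perm (Fin l → A)) :
    Equiv.Perm (Fin (k + l) → A) :=
  (Fin.appendEquiv k l).permCongr (F.prodCongr G)

theorem tensor_append {A : Type*} {k l : ℕ} (F : Equiv.Perm (Fin k → A))
    (G : Equiv.Perm (Fin l → A)) (u : Fin k → A) (v : Fin l → A) :
    tensor F G (Fin.append u v) = Fin.append (F u) (G v) := by
  have h : (Fin.appendEquiv k l).symm (Fin.append u v) = (u, v) :=
    (Fin.appendEquiv k l).symm_apply_apply (u, v)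
  simp only [tensor, Equiv.permCongr_apply, h]
  rfl

/-- The controlled gate `w-F`: it maps `wu` to `wF(u)` and fixes every other input. -/
def control {A : Type*} [DecidableEq A] {l k : ℕ} (w : Fin l → A) (F : Equiv.Perm (Fin k → A)) :
    Equiv.Perm (Fin (l + k) → A) :=
  (Fin.appendEquiv l k).permCongr (Equiv.prodCongrRight fun x => if x = w then F else 1)

theorem control_append {A : Type*} [DecidableEq A] {l k : ℕ} (w : Fin l → A)
    (F : Equiv.Perm (Fin k → A)) (x : Fin l → A) (u : Fin k → A) :
    control w F (Fin.append x u) = Fin.append x (if x = w then F u else u) := by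
  have h : (Fin.appendEquiv l k).symm (Fin.append x u) = (x, u) :=
    (Fin.appendEquiv l k).symm_apply_apply (x, u)
  simp only [control, Equiv.permCongr_apply, h, Equiv.prodCongrRight_apply]
  split_ifs <;> rfl

/-- The gate `CC_m = a-τ_{a^m, κ^m}` on `1 + m` symbols: if the first symbol is `a`, it exchanges
the strings `a^m` and `κ^m` on the remaining `m` symbols; all other inputs are fixed. -/
def CC {A : Type*} [DecidableEq A] (a κ : A) (m : ℕ) : Gate A :=
  ⟨1 + m, control (fun _ : Fin 1 => a)
    (Equiv.swap (fun _ : Fin m => a) (fun _ : Fin m => κ))⟩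

/-- The number of positions of the string `w` that are occupied by elements of `B`. -/
def count {A : Type*} [DecidableEq A] (B : Finset A) {n : ℕ} (w : Fin n → A) : ℕ :=
  (Finset.univ.filter fun i => w i ∈ B).card

theorem count_append {A : Type*} [DecidableEq A] (B : Finset A) {k l : ℕ} (u : Fin k → A)
    (v : Fin l → A) : count B (Fin.append u v) = count B u + count B v := by
  simp only [count, Finset.card_filter, Fin.sum_univ_add, Fin.append_left, Fin.append_right]

theorem count_comp {A : Type*} [DecidableEq A] (B : Finset A) {n : ℕ} (w : Fin n → A)
    (σ : Equiv.Perm (Fin n)) : count B (w ∘ σ) = count B w := by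
  simp only [count, Finset.card_filter, Function.comp_apply]
  exact Equiv.sum_comp σ (fun i => if w i ∈ B then 1 else 0)

/-- `F` is mod-`m`-preserving (with respect to the symbol `κ`): for every input, the numbers of
`κ`'s in the input and in the output are congruent modulo `m`. -/
def IsModPreserving {A : Type*} [DecidableEq A] (κ : A) (m : ℕ) (F : Gate A) : Prop :=
  ∀ w : Fin F.1 → A, count {κ} (F.2 w) ≡ count {κ} w [MOD m]

end Gate

/-- A reversible gate class: a set of reversible gates closed under the permutation,
tensor product, composition and ancilla rules. -/
@[ext]
structure GateClass (A : Type*) where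
  carrier : Set (Gate A)
  perm_mem : ∀ (n : ℕ) (σ : Equiv.Perm (Fin n)), (⟨n, Gate.permGate A σ⟩ : Gate A) ∈ carrier
  tensor_mem : ∀ (k l : ℕ) (F : Equiv.Perm (Fin k → A)) (G : Equiv.Perm (Fin l → A)),
    (⟨k, F⟩ : Gate A) ∈ carrier → (⟨l, G⟩ : Gate A) ∈ carrier →
      (⟨k + l, Gate.tensor F G⟩ : Gate A) ∈ carrier
  comp_mem : ∀ (k : ℕ) (F G : Equiv.Perm (Fin k → A)),
    (⟨k, F⟩ : Gate A) ∈ carrier → (⟨k, G⟩ : Gate A) ∈ carrier →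
      (⟨k, F * G⟩ : Gate A) ∈ carrier
  ancilla_mem : ∀ (l n : ℕ) (a : Fin l → A) (F : Equiv.Perm (Fin (l + n) → A))
    (F' : Equiv.Perm (Fin n → A)), (⟨l + n, F⟩ : Gate A) ∈ carrier →
      (∀ b : Fin n → A, F (Fin.append a b) = Fin.append a (F' b)) →
        (⟨n, F'⟩ : Gate A) ∈ carrier

namespace GateClass

/-- Gate classes are ordered by inclusion. -/
instance {A : Type*} : PartialOrder (GateClass A) :=
  PartialOrder.lift GateClass.carrier fun _ _ => GateClass.ext

/-- Intersection of a family of gate classes. -/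
instance {A : Type*} : InfSet (GateClass A) where
  sInf 𝒮 :=
    { carrier := {F | ∀ S ∈ 𝒮, F ∈ S.carrier}
      perm_mem := fun n σ S _ => S.perm_mem n σ
      tensor_mem := fun k l F G hF hG S hS => S.tensor_mem k l F G (hF S hS) (hG S hS)
      comp_mem := fun k F G hF hG S hS => S.comp_mem k F G (hF S hS) (hG S hS)
      ancilla_mem := fun l n a F F' hF h S hS => S.ancilla_mem l n a F F' (hF S hS) h }

/-- The complete lattice of gate classes: meets are intersections. -/
instance {A : Type*} : CompleteLattice (GateClass A) :=
  completeLatticeOfInf (GateClass A) fun _ =>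
    ⟨fun _ hS _ hF => hF _ hS, fun _ hT _ hF _ hS => hT hS hF⟩

/-- The gate class `⟨X⟩` generated by a set `X` of gates: the smallest gate class containing `X`. -/
def generate {A : Type*} (X : Set (Gate A)) : GateClass A :=
  sInf {S : GateClass A | X ⊆ S.carrier}

theorem subset_generate {A : Type*} (X : Set (Gate A)) : X ⊆ (generate X).carrier :=
  fun _ hF _ hS => hS hF

theorem generate_le {A : Type*} {X : Set (Gate A)} {S : GateClass A} (h : X ⊆ S.carrier) :
    generate X ≤ S :=
  fun _ hF => hF S h

/-- The class `CONS_P` of `P`-conservative gates, for a partition `P` of the alphabet: gates that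
preserve, for each block `B` of `P`, the total number of occurrences of elements of `B`. -/
def CONS {A : Type*} [Fintype A] [DecidableEq A]
    (P : Finpartition (Finset.univ : Finset A)) : GateClass A where
  carrier := {F | ∀ B ∈ P.parts, ∀ w : Fin F.1 → A, Gate.count B (F.2 w) = Gate.count B w}
  perm_mem := fun _ σ B _ w => Gate.count_comp B w σ
  tensor_mem := by
    intro k l F G hF hG B hB w
    obtain ⟨⟨u, v⟩, rfl⟩ := (Fin.appendEquiv k l).surjective w
    change Gate.count B (Gate.tensor F G (Fin.append u v)) = Gate.count B (Fin.append u v)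
    rw [Gate.tensor_append, Gate.count_append, Gate.count_append]
    exact congrArg₂ (· + ·) (hF B hB u) (hG B hB v)
  comp_mem := fun _ _ G hF hG B hB w => (hF B hB (G w)).trans (hG B hB w)
  ancilla_mem := by
    intro l n a F F' hF h B hB w
    have h1 := hF B hB (Fin.append a w)
    change Gate.count B (F (Fin.append a w)) = Gate.count B (Fin.append a w) at h1
    rw [h, Gate.count_append, Gate.count_append] at h1
    exact Nat.add_left_cancel h1

end GateClass

/-- The natural numbers (including `0`), to be ordered by divisibility. -/
structure DivNat where
  toNat : ℕ

namespace DivNat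

/-- The lattice `(ℕ, ∣)`: `n ≤ m` if and only if `n ∣ m`, with joins `lcm` and meets `gcd`. -/
instance : Lattice DivNat where
  le n m := n.toNat ∣ m.toNat
  le_refl n := dvd_refl n.toNat
  le_trans _ _ _ := dvd_trans
  le_antisymm := fun ⟨_⟩ ⟨_⟩ h h' => congrArg DivNat.mk (Nat.dvd_antisymm h h')
  sup n m := ⟨Nat.lcm n.toNat m.toNat⟩
  le_sup_left n m := Nat.dvd_lcm_left n.toNat m.toNat
  le_sup_right n m := Nat.dvd_lcm_right n.toNat m.toNat
  sup_le _ _ _ := Nat.lcm_dvd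
  inf n m := ⟨Nat.gcd n.toNat m.toNat⟩
  inf_le_left n m := Nat.gcd_dvd_left n.toNat m.toNat
  inf_le_right n m := Nat.gcd_dvd_right n.toNat m.toNat
  le_inf _ _ _ := Nat.dvd_gcd

end DivNat

/-! Call two strings of equal length linked in a class C when the transposition of them lies in C.
If C contains the weight-preserving gates (weight = number of `κ`), linkedness is an equivalence
relation invariant under C, and it depends only on the weight difference
(`Linked.of_weight_sub_eq`). The differences of linked strings form a subgroup gℤ.

A gate F that shifts every weight by a multiple of g links each w to F w, so it is a product of
transpositions in C. Conversely, any F in C shifts all weights by the same amount c modulo g.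
Comparing the sums of ζ^weight before and after F, for ζ of order g, gives ζ^c = 1, because the sum
(k - 1 + ζ)^n is nonzero when k ≥ 3. So C is the class of mod-|g|-preserving gates
(`exists_eq_modClass`). -/

namespace Gate

variable {A : Type*}

theorem append_inj {k l : ℕ} {u u' : Fin k → A} {v v' : Fin l → A} :
    Fin.append u v = Fin.append u' v' ↔ u = u' ∧ v = v' := by
  rw [← Prod.mk.injEq]
  exact (Fin.appendEquiv k l).apply_eq_iff_eq (x := (u, v)) (y := (u', v'))

theorem tensor_one_append {k l : ℕ} (F : Equiv.Perm (Fin k → A)) (u : Fin k → A)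
    (v : Fin l → A) : tensor F 1 (Fin.append u v) = Fin.append (F u) v :=
  tensor_append F 1 u v

/-! ### Weights and their generating function -/

variable [DecidableEq A]

/-- The number of occurrences of `κ`, as an integer. -/
def weight (κ : A) {n : ℕ} (w : Fin n → A) : ℤ := count {κ} w

theorem weight_append (κ : A) {k l : ℕ} (u : Fin k → A) (v : Fin l → A) :
    weight κ (Fin.append u v) = weight κ u + weight κ v := by
  simp [weight, count_append]

theorem weight_const_self (κ : A) (n : ℕ) : weight κ (fun _ : Fin n => κ) = n := by
  simp [weight, count]

theorem weight_const_of_ne {κ a : A} (h : a ≠ κ) (n : ℕ) :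
    weight κ (fun _ : Fin n => a) = 0 := by
  simp [weight, count, h]

theorem weight_update {κ b : A} {n : ℕ} {w : Fin n → A} {p : Fin n} (hp : w p ≠ κ)
    (hb : b ≠ κ) : weight κ (Function.update w p b) = weight κ w := by
  unfold weight count
  congr 2
  ext i
  by_cases h : i = p
  · subst h; simp [hp, hb]
  · simp [h]

theorem exists_ne_of_weight_lt {κ : A} {n : ℕ} {s t : Fin n → A}
    (h : weight κ s < weight κ t) : ∃ p, s p ≠ κ := by
  by_contra! hs
  have hs' : s = fun _ => κ := funext hs
  rw [hs', weight_const_self] at h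
  have : count {κ} t ≤ n := (Finset.card_filter_le _ _).trans (by simp)
  have : weight κ t ≤ n := Int.ofNat_le.2 this
  omega

theorem isModPreserving_iff {κ : A} {m : ℕ} {F : Gate A} :
    IsModPreserving κ m F ↔ ∀ w, (m : ℤ) ∣ weight κ (F.2 w) - weight κ w := by
  refine forall_congr' fun w => ?_
  rw [Nat.ModEq.comm, Nat.modEq_iff_dvd]
  rfl

theorem isModPreserving_swap {κ : A} {m n : ℕ} {s t : Fin n → A}
    (h : (m : ℤ) ∣ weight κ t - weight κ s) :
    IsModPreserving κ m ⟨n, Equiv.swap s t⟩ := by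
  refine isModPreserving_iff.2 fun w => ?_
  dsimp only
  rw [Equiv.swap_apply_def]
  split_ifs with h₁ h₂
  · rwa [h₁]
  · rw [h₂, ← neg_sub]; exact h.neg_right
  · simp

/-- The generating function of the weight on `A^n`. -/
theorem sum_pow_weight [Fintype A] (κ : A) (n : ℕ) (ζ : ℂ) :
    ∑ w : Fin n → A, ζ ^ weight κ w = (Fintype.card A - 1 + ζ) ^ n := by
  have h₁ : (Fintype.card A - 1 + ζ : ℂ) = ∑ x : A, if x = κ then ζ else 1 := by
    rw [← Finset.add_sum_erase _ _ (Finset.mem_univ κ), if_pos rfl, add_comm,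
      Finset.sum_congr rfl fun x hx => if_neg (Finset.ne_of_mem_erase hx)]
    have : 1 ≤ Fintype.card A := Fintype.card_pos_iff.2 ⟨κ⟩
    simp [Finset.card_erase_of_mem, this, Finset.card_univ]
  rw [h₁, Fintype.sum_pow]
  refine Finset.sum_congr rfl fun w _ => ?_
  simp [weight, count, Finset.prod_ite]

/-- For m ≥ 1 the sum is nonzero because |ζ| = 1 < 2 ≤ k - 1. For m = 0 a primitive root is a number
of infinite order, such as 2. -/
theorem exists_isPrimitiveRoot_add_ne_zero {k : ℕ} (hk : 3 ≤ k) (m : ℕ) :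
    ∃ ζ : ℂ, ζ ≠ 0 ∧ IsPrimitiveRoot ζ m ∧ (k - 1 + ζ : ℂ) ≠ 0 := by
  have hk' : (3 : ℝ) ≤ k := by exact_mod_cast hk
  rcases eq_or_ne m 0 with rfl | hm
  · refine ⟨2, two_ne_zero, ⟨by simp, fun l hl => ?_⟩, ?_⟩
    · have : (2 : ℕ) ^ l = 1 := by exact_mod_cast hl
      simp_all
    · intro h
      have := congrArg Complex.re h
      norm_num at this
      linarith
  · have hζ := Complex.isPrimitiveRoot_exp m hm
    refine ⟨_, hζ.ne_zero hm, hζ, fun h => ?_⟩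
    have h₁ := hζ.norm'_eq_one hm
    rw [← neg_eq_of_add_eq_zero_right h, norm_neg] at h₁
    have h₂ : ((k : ℂ) - 1) = ((k - 1 : ℝ) : ℂ) := by push_cast; rfl
    rw [h₂, Complex.norm_real, Real.norm_of_nonneg (by linarith)] at h₁
    linarith

/-- A bijection of `A^n` that shifts the weight by a constant `c` modulo `m` has `m ∣ c`. -/
theorem dvd_of_forall_dvd_weight_sub [Fintype A] (hA : 3 ≤ Fintype.card A) {κ : A} {m n : ℕ}
    (F : Equiv.Perm (Fin n → A)) {c : ℤ}
    (h : ∀ w, (m : ℤ) ∣ weight κ (F w) - weight κ w - c) : (m : ℤ) ∣ c := by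
  obtain ⟨ζ, hζ₀, hζ, hne⟩ := exists_isPrimitiveRoot_add_ne_zero hA m
  -- Reindexing the sum along the bijection F multiplies it by ζ^c.
  have h₁ : ∑ w : Fin n → A, ζ ^ weight κ w = ζ ^ c * ∑ w : Fin n → A, ζ ^ weight κ w := by
    conv_lhs => rw [← Equiv.sum_comp F]
    rw [Finset.mul_sum]
    refine Finset.sum_congr rfl fun w _ => ?_
    rw [← zpow_add₀ hζ₀, show weight κ (F w) = (weight κ (F w) - weight κ w - c) +
      (c + weight κ w) by ring, zpow_add₀ hζ₀ (_ - _ - c), (hζ.zpow_eq_one_iff_dvd _).2 (h w),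
      one_mul]
  rw [sum_pow_weight] at h₁
  exact (hζ.zpow_eq_one_iff_dvd _).1
    ((mul_eq_right₀ (pow_ne_zero n hne)).1 h₁.symm)

end Gate

/-! ### The mod-m-preserving classes -/

namespace GateClass

open Gate

variable {A : Type*}

/-- The class of mod-`m`-preserving gates. -/
def modClass [DecidableEq A] (κ : A) (m : ℕ) : GateClass A where
  carrier := {F | IsModPreserving κ m F}
  perm_mem _ σ w := by
    change count {κ} (w ∘ σ) ≡ _ [MOD m]
    rw [count_comp]
  tensor_mem := by
    intro k l F G hF hG w
    obtain ⟨⟨u, v⟩, rfl⟩ := (Fin.appendEquiv k l).surjective w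
    change count {κ} (tensor F G (Fin.append u v)) ≡ count {κ} (Fin.append u v) [MOD m]
    rw [tensor_append, count_append, count_append]
    exact (hF u).add (hG v)
  comp_mem := fun _ _ G hF hG w => (hF (G w)).trans (hG w)
  ancilla_mem := by
    intro l n a F F' hF h w
    have h₁ := hF (Fin.append a w)
    change count {κ} (F (Fin.append a w)) ≡ count {κ} (Fin.append a w) [MOD m] at h₁
    rw [h, count_append, count_append] at h₁
    exact Nat.ModEq.add_left_cancel' _ h₁

theorem modClass_le_modClass_iff [DecidableEq A] {κ a : A} (ha : a ≠ κ) {m n : ℕ} :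
    modClass κ n ≤ modClass κ m ↔ m ∣ n := by
  constructor
  · intro h
    -- This swap changes the weight of a^n by exactly n.
    have h₁ : (⟨n, Equiv.swap (fun _ => a) (fun _ => κ)⟩ : Gate A) ∈ (modClass κ m).carrier :=
      h (isModPreserving_swap (by rw [weight_const_self, weight_const_of_ne ha, sub_zero]))
    have h₂ := isModPreserving_iff.1 h₁ fun _ => a
    rw [Equiv.swap_apply_left, weight_const_self, weight_const_of_ne ha, sub_zero] at h₂
    exact_mod_cast h₂
  · exact fun h _ hF w => (hF w).of_dvd h

theorem CC_mem_modClass_iff [DecidableEq A] {κ a : A} (ha : a ≠ κ) {m n : ℕ} :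
    CC a κ m ∈ (modClass κ n).carrier ↔ n ∣ m := by
  refine isModPreserving_iff.trans ⟨fun h => ?_, fun h w => ?_⟩
  · have h₁ := h (Fin.append (fun _ => a) fun _ => a)
    change (n : ℤ) ∣ weight κ (control _ _ _) - weight (n := 1 + m) κ _ at h₁
    rw [control_append, if_pos rfl, Equiv.swap_apply_left, weight_append, weight_append,
      weight_const_self, weight_const_of_ne ha, weight_const_of_ne ha, zero_add, add_zero,
      sub_zero] at h₁
    exact_mod_cast h₁
  · obtain ⟨⟨u, v⟩, rfl⟩ := (Fin.appendEquiv 1 m).surjective w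
    change (n : ℤ) ∣ weight κ (control _ _ (Fin.append u v)) - weight κ (Fin.append u v)
    rw [control_append, weight_append, weight_append, add_sub_add_left_eq_sub]
    split_ifs
    · refine (isModPreserving_iff (F := ⟨m, _⟩)).1 (isModPreserving_swap ?_) v
      rw [weight_const_self, weight_const_of_ne ha, sub_zero]
      exact_mod_cast h
    · simp

/-- The only other block is the complement of {κ}, whose count is n minus the weight. Congruence
modulo 0 is equality. -/
theorem CONS_eq_modClass_zero [Fintype A] [DecidableEq A]
    {P : Finpartition (Finset.univ : Finset A)}
    (hP : P.parts.val.map Finset.card = {Fintype.card A - 1, 1}) {κ : A} (hκ : {κ} ∈ P.parts) :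
    CONS P = modClass κ 0 := by
  have hcard : P.parts.card = 2 := by
    have := congrArg Multiset.card hP
    simpa using this
  have hparts : ∀ B ∈ P.parts, B = {κ} ∨ B = {κ}ᶜ := by
    obtain ⟨X, Y, hXY, hp⟩ := Finset.card_eq_two.1 hcard
    have hdisj : Disjoint X Y := P.disjoint (by simp [hp]) (by simp [hp]) hXY
    have hsup : X ∪ Y = Finset.univ := by
      have := P.sup_parts
      simpa [hp] using this
    have hc : IsCompl X Y := ⟨hdisj, codisjoint_iff.2 hsup⟩
    intro B hB
    rw [hp] at hB hκ
    simp only [Finset.mem_insert, Finset.mem_singleton] at hB hκ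
    rcases hκ with rfl | rfl
    · exact hB.imp_right fun h => h.trans hc.compl_eq.symm
    · exact hB.symm.imp_right fun h => h.trans hc.symm.compl_eq.symm
  have hcompl : ∀ {n : ℕ} (w : Fin n → A), count {κ} w + count {κ}ᶜ w = n := by
    intro n w
    have := Finset.card_filter_add_card_filter_not (s := Finset.univ) fun i => w i ∈ ({κ} : Finset A)
    simpa [count] using this
  ext F
  constructor
  · intro hF w
    rw [hF _ hκ w]
  · intro hF B hB w
    have h₁ : count {κ} (F.2 w) = count {κ} w := Nat.modEq_zero_iff.1 (hF w)
    rcases hparts B hB with rfl | rfl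
    · exact h₁
    · have h₂ := hcompl w
      have h₃ := hcompl (F.2 w)
      omega

/-! ### Linked strings -/

theorem one_mem (C : GateClass A) (n : ℕ) : (⟨n, 1⟩ : Gate A) ∈ C.carrier :=
  C.perm_mem n 1

/-- The group of gates of arity `n` in a gate class. -/
def group [Finite A] (C : GateClass A) (n : ℕ) : Subgroup (Equiv.Perm (Fin n → A)) where
  carrier := {F | (⟨n, F⟩ : Gate A) ∈ C.carrier}
  mul_mem' := C.comp_mem n _ _
  one_mem' := C.one_mem n
  inv_mem' {F} hF := by
    have h : ∀ j : ℕ, (⟨n, F ^ j⟩ : Gate A) ∈ C.carrier := by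
      intro j
      induction j with
      | zero => exact C.one_mem n
      | succ j ih => rw [pow_succ]; exact C.comp_mem n _ _ ih hF
    -- No axiom provides inverses, but a permutation of a finite set has finite order, so its
    -- inverse is one of its powers.
    obtain ⟨j, hj⟩ := (isOfFinOrder_of_finite F).mem_powers_iff_mem_zpowers.2
      (Subgroup.inv_mem _ (Subgroup.mem_zpowers F))
    exact hj ▸ h j

theorem tensor_one_mem [Finite A] {C : GateClass A} {k : ℕ} {F : Equiv.Perm (Fin k → A)} (hF : F ∈ C.group k) (l : ℕ) :
    tensor F (1 : Equiv.Perm (Fin l → A)) ∈ C.group (k + l) :=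
  C.tensor_mem k l F 1 hF (C.one_mem l)

variable [Fintype A] [DecidableEq A] {C : GateClass A}

/-- Two strings are linked if the gate exchanging them belongs to the class. -/
def Linked (C : GateClass A) {n : ℕ} (s t : Fin n → A) : Prop := Equiv.swap s t ∈ C.group n

theorem Linked.symm {n : ℕ} {s t : Fin n → A} (h : C.Linked s t) : C.Linked t s := by
  rwa [Linked, Equiv.swap_comm]

/-- Conjugating a transposition by F relabels its two points. -/
theorem Linked.map {n : ℕ} {s t : Fin n → A} (h : C.Linked s t) {F : Equiv.Perm (Fin n → A)}
    (hF : F ∈ C.group n) : C.Linked (F s) (F t) := by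
  rw [Linked, Equiv.swap_apply_apply]
  exact mul_mem (mul_mem hF h) (inv_mem hF)

theorem Linked.trans {n : ℕ} {s t u : Fin n → A} (h : C.Linked s t) (h' : C.Linked t u) :
    C.Linked s u := by
  by_cases hs : s = t
  · rwa [hs]
  by_cases hu : s = u
  · rw [Linked, hu, Equiv.swap_self]; exact Subgroup.one_mem _
  have := h.map h'
  rwa [Equiv.swap_apply_of_ne_of_ne hs hu, Equiv.swap_apply_left] at this

/-- The ancilla rule, with u as the ancilla string. -/
theorem Linked.of_append_left {l n : ℕ} (u : Fin l → A) {s t : Fin n → A}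
    (h : C.Linked (Fin.append u s) (Fin.append u t)) : C.Linked s t := by
  refine C.ancilla_mem l n u _ _ h fun b => ?_
  simp only [Equiv.swap_apply_def, append_inj, true_and]
  split_ifs <;> rfl

theorem linked_of_weight_eq {κ : A} (hC : modClass κ 0 ≤ C) {n : ℕ} {s t : Fin n → A}
    (h : weight κ s = weight κ t) : C.Linked s t :=
  hC (isModPreserving_swap (by simp [h]))

/-- Since s is not all `κ` and k ≥ 3, changing one symbol gives r ≠ s of the same weight. Then ru
and su are linked, and the gate (s t) ⊗ 1 fixes ru and sends su to tu. -/
theorem Linked.append_of_lt (hA : 3 ≤ Fintype.card A) {κ : A} (hC : modClass κ 0 ≤ C) {n l : ℕ}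
    {s t : Fin n → A} (h : C.Linked s t) (u : Fin l → A) (hst : weight κ s < weight κ t) :
    C.Linked (Fin.append s u) (Fin.append t u) := by
  obtain ⟨p, hp⟩ := exists_ne_of_weight_lt hst
  obtain ⟨b, hb⟩ : ∃ b, b ∉ ({κ, s p} : Finset A) := by
    by_contra! hb
    have h₁ := Finset.card_le_card fun x (_ : x ∈ Finset.univ) => hb x
    have h₂ := Finset.card_le_two (a := κ) (b := s p)
    rw [Finset.card_univ] at h₁
    omega
  simp only [Finset.mem_insert, Finset.mem_singleton, not_or] at hb
  set r := Function.update s p b with hr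
  have hwr : weight κ r = weight κ s := weight_update hp hb.1
  have hrs : r ≠ s := fun h => hb.2 (by rw [← h, hr, Function.update_self])
  have hrt : r ≠ t := fun h => by rw [← hwr, h] at hst; exact lt_irrefl _ hst
  have h₁ : C.Linked (Fin.append r u) (Fin.append s u) :=
    linked_of_weight_eq hC (by rw [weight_append, weight_append, hwr])
  have h₂ := h₁.map (tensor_one_mem h l)
  rw [tensor_one_append, tensor_one_append, Equiv.swap_apply_left,
    Equiv.swap_apply_of_ne_of_ne hrs hrt] at h₂
  exact h₁.symm.trans h₂

theorem Linked.append (hA : 3 ≤ Fintype.card A) {κ : A} (hC : modClass κ 0 ≤ C) {n l : ℕ}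
    {s t : Fin n → A} (h : C.Linked s t) (u : Fin l → A) :
    C.Linked (Fin.append s u) (Fin.append t u) := by
  rcases lt_trichotomy (weight κ s) (weight κ t) with hst | hst | hst
  · exact h.append_of_lt hA hC u hst
  · exact linked_of_weight_eq hC (by rw [weight_append, weight_append, hst])
  · exact (h.symm.append_of_lt hA hC u hst).symm

/-- Whether two strings are linked depends only on the difference of their weights. -/
theorem Linked.of_weight_sub_eq (hA : 3 ≤ Fintype.card A) {κ : A} (hC : modClass κ 0 ≤ C)
    {n l : ℕ} {s t : Fin n → A} {u v : Fin l → A} (h : C.Linked s t)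
    (hw : weight κ v - weight κ u = weight κ t - weight κ s) : C.Linked u v := by
  -- The chain is su ~ tu ~ sv, the last two having equal weight; then the prefix s is cancelled.
  refine Linked.of_append_left s ((h.append hA hC u).trans (linked_of_weight_eq hC ?_))
  rw [weight_append, weight_append]
  omega

/-- The group of differences of weights of linked strings. -/
def weightDiff (hA : 3 ≤ Fintype.card A) {κ : A} (hC : modClass κ 0 ≤ C) : AddSubgroup ℤ where
  carrier := {d | ∃ (n : ℕ) (s t : Fin n → A), C.Linked s t ∧ weight κ t - weight κ s = d}
  zero_mem' := ⟨0, Fin.elim0, Fin.elim0, linked_of_weight_eq hC rfl, sub_self _⟩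
  neg_mem' := by
    rintro _ ⟨n, s, t, h, rfl⟩
    exact ⟨n, t, s, h.symm, (neg_sub _ _).symm⟩
  add_mem' := by
    rintro _ _ ⟨n, s, t, h, rfl⟩ ⟨l, u, v, h', rfl⟩
    -- Differences add along su ~ tu ~ tv.
    refine ⟨n + l, Fin.append s u, Fin.append t v, (h.append hA hC u).trans
      (h'.of_weight_sub_eq hA hC ?_), ?_⟩ <;>
    · simp only [weight_append]
      ring

theorem linked_iff_mem_weightDiff (hA : 3 ≤ Fintype.card A) {κ : A} (hC : modClass κ 0 ≤ C)
    {n : ℕ} {s t : Fin n → A} :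
    C.Linked s t ↔ weight κ t - weight κ s ∈ weightDiff hA hC :=
  ⟨fun h => ⟨n, s, t, h, rfl⟩, fun ⟨_, _, _, h, hw⟩ => h.of_weight_sub_eq hA hC hw.symm⟩

/-- A group generated by transpositions contains every finitely supported permutation that keeps
each point in its orbit. -/
theorem mem_group_of_forall_linked {n : ℕ} {F : Equiv.Perm (Fin n → A)}
    (h : ∀ w, C.Linked w (F w)) : F ∈ C.group n := by
  let S : Set (Equiv.Perm (Fin n → A)) := {σ | σ.IsSwap ∧ σ ∈ C.group n}
  have hS : Subgroup.closure S ≤ C.group n := (Subgroup.closure_le _).2 fun σ hσ => hσ.2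
  refine hS ((mem_closure_isSwap fun σ hσ => hσ.1).2 ⟨Set.toFinite _, fun w => ?_⟩)
  by_cases hw : w = F w
  · rw [← hw]; exact MulAction.mem_orbit_self w
  · exact ⟨⟨Equiv.swap w (F w), Subgroup.subset_closure ⟨⟨w, F w, hw, rfl⟩, h w⟩⟩,
      Equiv.swap_apply_left w (F w)⟩

/-- Every gate class containing all weight-preserving gates is the class of mod-`m`-preserving
gates for some `m`. -/
theorem exists_eq_modClass (hA : 3 ≤ Fintype.card A) {κ : A} (hC : modClass κ 0 ≤ C) :
    ∃ m, C = modClass κ m := by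
  obtain ⟨g, hg⟩ := Int.subgroup_cyclic (weightDiff hA hC)
  have hmem : ∀ {n : ℕ} {s t : Fin n → A},
      C.Linked s t ↔ (g.natAbs : ℤ) ∣ weight κ t - weight κ s := by
    intro n s t
    rw [linked_iff_mem_weightDiff hA hC, hg, ← AddSubgroup.zmultiples_eq_closure,
      Int.mem_zmultiples_iff, Int.natAbs_dvd]
  refine ⟨g.natAbs, le_antisymm ?_ ?_⟩
  · rintro ⟨n, F⟩ hF
    have hconst : ∀ s t : Fin n → A, (g.natAbs : ℤ) ∣
        weight κ (F s) - weight κ s - (weight κ (F t) - weight κ t) := by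
      intro s t
      -- Applying F ⊗ 1 to the linked strings ts and st compares the shift of F at s with that at t.
      have h₁ : C.Linked (Fin.append t s) (Fin.append s t) :=
        linked_of_weight_eq hC (by rw [weight_append, weight_append, add_comm])
      have h₂ := hmem.1 (h₁.map (tensor_one_mem hF n))
      rw [tensor_one_append, tensor_one_append, weight_append, weight_append] at h₂
      convert h₂ using 1
      ring
    exact isModPreserving_iff.2 fun w => dvd_of_forall_dvd_weight_sub hA F fun s => hconst s w
  · rintro ⟨n, F⟩ hF
    exact mem_group_of_forall_linked fun w => hmem.2 (isModPreserving_iff.1 hF w)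

/-! ### Generators and the anti-isomorphism -/

/-- By the classification the generated class is `modClass κ n` for some n, and containing `CC a κ
m` forces n ∣ m. -/
theorem generate_union_CC {κ a : A} (hA : 3 ≤ Fintype.card A) (ha : a ≠ κ) (m : ℕ) :
    generate ((modClass κ 0).carrier ∪ {CC a κ m}) = modClass κ m := by
  have hsub := subset_generate ((modClass κ 0).carrier ∪ {CC a κ m})
  obtain ⟨n, hn⟩ := exists_eq_modClass (κ := κ) hA fun F hF => hsub (Or.inl hF)
  refine le_antisymm (generate_le (Set.union_subset ?_ ?_)) ?_
  · exact (modClass_le_modClass_iff ha).2 (dvd_zero m)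
  · exact Set.singleton_subset_iff.2 ((CC_mem_modClass_iff ha).2 dvd_rfl)
  · rw [hn] at hsub ⊢
    exact (modClass_le_modClass_iff ha).2
      ((CC_mem_modClass_iff ha).1 (hsub (Or.inr rfl)))

/-- The gate classes containing all weight-preserving gates form the dual of `(ℕ, ∣)`. -/
noncomputable def modClassIso {κ a : A} (hA : 3 ≤ Fintype.card A) (ha : a ≠ κ) :
    DivNatᵒᵈ ≃o Set.Ici (modClass κ 0) :=
  RelIso.ofSurjective
    (OrderEmbedding.ofMapLEIff
      (fun m : DivNatᵒᵈ => (⟨modClass κ (OrderDual.ofDual m).toNat,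
        (modClass_le_modClass_iff ha).2 (dvd_zero _)⟩ : Set.Ici (modClass κ 0)))
      fun _ _ => modClass_le_modClass_iff ha)
    fun ⟨_, hC⟩ => (exists_eq_modClass hA hC).imp' (fun m => OrderDual.toDual ⟨m⟩)
      fun _ h => Subtype.ext h.symm

end GateClass

theorem mainTheorem5 {A : Type*} [Fintype A] [DecidableEq A] (hA : 3 ≤ Fintype.card A)
    (P : Finpartition (Finset.univ : Finset A))
    (hP : P.parts.val.map Finset.card = {Fintype.card A - 1, 1})
    (κ a : A) (hκ : {κ} ∈ P.parts) (ha : a ≠ κ) :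
    ∃ Φ : DivNatᵒᵈ ≃o Set.Ici (GateClass.CONS P),
      (Φ (OrderDual.toDual ⟨0⟩) : GateClass A) = GateClass.CONS P ∧
      ∀ m : ℕ, 1 ≤ m →
        (Φ (OrderDual.toDual ⟨m⟩) : GateClass A) =
            GateClass.generate ((GateClass.CONS P).carrier ∪ {Gate.CC a κ m}) ∧
          (Φ (OrderDual.toDual ⟨m⟩) : GateClass A).carrier =
            {F : Gate A | Gate.IsModPreserving κ m F} := by
  rw [GateClass.CONS_eq_modClass_zero hP hκ]
  exact ⟨GateClass.modClassIso hA ha, rfl, fun m _ =>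
    ⟨(GateClass.generate_union_CC hA ha m).symm, rfl⟩⟩
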